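/- Let $\{a_n\}_{n\ge1}$ be positive numbers and $\{b_n\}_{n\ge1}$ real numbers, and let $P_n$ be the orthogonal polynomials of the first kind of the Jacobi matrix $\mathcal J$ with diagonal $\{b_n\}$ and off-diagonal $\{a_n\}$: $P_1=1$, $P_2(\lambda)=\frac{\lambda-b_1}{a_1}$ and $a_{n-1}P_{n-1}(\lambda)+b_nP_n(\lambda)+a_nP_{n+1}(\lambda)=\lambda P_n(\lambda)$ for $n\ge2$. For $N\ge1$ let $\mathcal J_N$ be the bounded self-adjoint operator in $l^2(\mathbb N)$ given by the Jacobi matrix with off-diagonal entries $a_1,\dots,a_{N-1},a_N,a_N,a_N,\dots$ and diagonal entries $b_1,\dots,b_{N-1},b_N,b_N,b_N,\dots$, and let $\rho_N$ be its scalar spectral measure at the first standard basis vector $e_1$, that is, the Borel probability measure on $\mathbb R$ with $\int f\,d\rho_N=\langle f(\mathcal J_N)e_1,e_1\rangle$ for every $f\in C_c(\mathbb R)$. (i) For every $\lambda\in\mathbb C\setminus[b_N-2a_N,b_N+2a_N]$ the characteristic equation $a_N\zeta^2+b_N\zeta+a_N=\lambda\zeta$ has exactly one root $z_N(\lambda)$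 with $|z_N(\lambda)|<1$; the function $z_N$ is analytic on this set, and for every $\lambda\in(b_N-2a_N,b_N+2a_N)$ its boundary value from the upper half-plane exists and equals $$z_N(\lambda)=\frac{\lambda-b_N}{2a_N}-i\sqrt{1-\Big(\frac{\lambda-b_N}{2a_N}\Big)^2}.$$ (ii) On $(b_N-2a_N,b_N+2a_N)$ the measure $\rho_N$ is absolutely continuous and its spectral density is, at every point $\lambda$ of this interval, $$\rho_N'(\lambda)=\frac{\sqrt{1-\left(\frac{\lambda-b_N}{2a_N}\right)^2}}{\pi a_N\,|P_{N+1}(\lambda)-z_N(\lambda)P_N(\lambda)|^2},$$ where $z_N(\lambda)$ is the boundary value in (i) and the denominator does not vanish; here $\rho_N'(\lambda)$ is the derivative of $t\mapsto\rho_N((-\infty,t])$ at $\lambda$ as well as the density of $\rho_N$ with respect to Lebesgue measure. -/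

import Mathlib

open MeasureTheory Filter Topology Polynomial
open scoped lp ENNReal InnerProductSpace ComplexInnerProductSpace

/-!
Jacobi matrices, their orthogonal polynomials and their spectral measures.

All sequences are indexed from `0`: the Lean index `n : ℕ` stands for the index `n + 1` of the
usual numbering `a_1, a_2, …`, `b_1, b_2, …`, `e_1, e_2, …`, `P_1, P_2, …`.
-/

noncomputable section

namespace Jacobi

/-- The complex Hilbert space `l²(ℕ)`. -/
abbrev Space : Type := lp (fun _ : ℕ => ℂ) 2

/-- The formal action on sequences of the Jacobi matrix with diagonal `b` and off-diagonal `a`: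
row `0` of the matrix is `(b 0, a 0, 0, …)`, and row `n + 1` has the entries
`a n, b (n + 1), a (n + 1)` in the columns `n, n + 1, n + 2` and zeros elsewhere. -/
def action (a b : ℕ → ℝ) (u : ℕ → ℂ) : ℕ → ℂ
  | 0 => (b 0 : ℂ) * u 0 + (a 0 : ℂ) * u 1
  | n + 1 => (a n : ℂ) * u n + (b (n + 1) : ℂ) * u (n + 1) + (a (n + 1) : ℂ) * u (n + 2)

/-- A sequence of reals is bounded. -/
def IsBddSeq (c : ℕ → ℝ) : Prop := ∃ C : ℝ, ∀ n, |c n| ≤ C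

theorem summable_sq (u : Space) : Summable fun n => ‖u n‖ ^ 2 := by
  have h := (memℓp_gen_iff (p := 2) (by simp)).1 (lp.memℓp u)
  simpa using h

theorem memlp_of_summable_sq {u : ℕ → ℂ} (h : Summable fun n => ‖u n‖ ^ 2) :
    Memℓp (E := fun _ : ℕ => ℂ) u 2 :=
  (memℓp_gen_iff (p := 2) (by simp)).2 (by simpa using h)

/-- The backward shift on `l²(ℕ)`. -/
def shiftL (u : Space) : Space :=
  ⟨fun n => u (n + 1), memlp_of_summable_sq ((summable_nat_add_iff 1).2 (summable_sq u))⟩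

/-- The forward shift of a sequence. -/
def shiftSeq (u : ℕ → ℂ) : ℕ → ℂ
  | 0 => 0
  | n + 1 => u n

/-- The forward shift on `l²(ℕ)`. -/
def shiftR (u : Space) : Space :=
  ⟨shiftSeq u, memlp_of_summable_sq ((summable_nat_add_iff 1).1 (by
    simpa [shiftSeq] using summable_sq u))⟩

/-- Multiplication by a bounded real sequence on `l²(ℕ)`. -/
def diag (c : ℕ → ℝ) (hc : IsBddSeq c) (u : Space) : Space :=
  ⟨fun n => (c n : ℂ) * u n, memlp_of_summable_sq (by
    obtain ⟨C, hC⟩ := hc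
    refine Summable.of_nonneg_of_le (fun n => by positivity) (fun n => ?_)
      ((summable_sq u).mul_left (C ^ 2))
    rw [norm_mul, mul_pow, Complex.norm_real, Real.norm_eq_abs]
    have := hC n
    gcongr)⟩

theorem inner_shiftR (u v : Space) : ⟪shiftR u, v⟫_ℂ = ⟪u, shiftL v⟫_ℂ := by
  have h := (lp.hasSum_inner (𝕜 := ℂ) (shiftR u) v).summable
  rw [lp.inner_eq_tsum, lp.inner_eq_tsum, h.tsum_eq_zero_add]
  simp [shiftR, shiftL, shiftSeq]

theorem inner_shiftL (u v : Space) : ⟪shiftL u, v⟫_ℂ = ⟪u, shiftR v⟫_ℂ := by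
  rw [← inner_conj_symm, ← inner_shiftR, inner_conj_symm]

theorem inner_diag (c : ℕ → ℝ) (hc : IsBddSeq c) (u v : Space) :
    ⟪diag c hc u, v⟫_ℂ = ⟪u, diag c hc v⟫_ℂ := by
  rw [lp.inner_eq_tsum, lp.inner_eq_tsum]
  refine tsum_congr fun n => ?_
  simp [diag]
  ring

theorem coe_pieces (a b : ℕ → ℝ) (ha : IsBddSeq a) (hb : IsBddSeq b) (u : Space) :
    ((diag a ha (shiftL u) + diag b hb u + shiftR (diag a ha u) : Space) : ℕ → ℂ)
      = action a b u := by
  funext n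
  rw [lp.coeFn_add, lp.coeFn_add, Pi.add_apply, Pi.add_apply]
  cases n with
  | zero =>
    simp only [action, diag, shiftL, shiftR, shiftSeq]
    ring
  | succ n =>
    simp only [action, diag, shiftL, shiftR, shiftSeq]
    ring

theorem memlp_action (a b : ℕ → ℝ) (ha : IsBddSeq a) (hb : IsBddSeq b) (u : Space) :
    Memℓp (E := fun _ : ℕ => ℂ) (action a b u) 2 := by
  rw [← coe_pieces a b ha hb u]
  exact lp.memℓp _

/-- A bounded Jacobi matrix as an everywhere defined linear operator on `l²(ℕ)`. -/
def linearOperator (a b : ℕ → ℝ) (ha : IsBddSeq a) (hb : IsBddSeq b) : Space →ₗ[ℂ] Space where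
  toFun u := ⟨action a b u, memlp_action a b ha hb u⟩
  map_add' u v := by
    ext n
    change action a b (u + v : Space) n = action a b u n + action a b v n
    cases n <;> simp only [action, lp.coeFn_add, Pi.add_apply] <;> ring
  map_smul' t u := by
    ext n
    change action a b (t • u : Space) n = t * action a b u n
    cases n <;> simp only [action, lp.coeFn_smul, Pi.smul_apply, smul_eq_mul] <;> ring

theorem isSymmetric_linearOperator (a b : ℕ → ℝ) (ha : IsBddSeq a) (hb : IsBddSeq b) :
    (linearOperator a b ha hb).IsSymmetric := by
  have key : ∀ u : Space, linearOperator a b ha hb u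
      = diag a ha (shiftL u) + diag b hb u + shiftR (diag a ha u) := by
    intro u
    apply lp.ext
    rw [coe_pieces]
    rfl
  intro u v
  rw [key, key]
  simp only [inner_add_left, inner_add_right, inner_diag, inner_shiftL, inner_shiftR]
  ring

/-- A bounded Jacobi matrix as a bounded operator on `l²(ℕ)`. -/
def operator (a b : ℕ → ℝ) (ha : IsBddSeq a) (hb : IsBddSeq b) : Space →L[ℂ] Space :=
  ⟨linearOperator a b ha hb, (isSymmetric_linearOperator a b ha hb).continuous⟩

theorem operator_apply (a b : ℕ → ℝ) (ha : IsBddSeq a) (hb : IsBddSeq b) (u : Space) :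
    (operator a b ha hb u : ℕ → ℂ) = action a b u := rfl

theorem isSelfAdjoint_operator (a b : ℕ → ℝ) (ha : IsBddSeq a) (hb : IsBddSeq b) :
    IsSelfAdjoint (operator a b ha hb) :=
  ContinuousLinearMap.isSelfAdjoint_iff_isSymmetric.2 (isSymmetric_linearOperator a b ha hb)

section SpectralMeasure

variable {H : Type*} [NormedAddCommGroup H] [InnerProductSpace ℂ H] [CompleteSpace H]

/-- The positive functional `f ↦ ⟨f(T) v, v⟩` on compactly supported continuous functions, where
`f(T)` is given by the continuous functional calculus of the bounded self-adjoint operator `T`. -/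
def spectralFunctional (T : H →L[ℂ] H) (v : H) :
    CompactlySupportedContinuousMap ℝ ℝ →ₚ[ℝ] ℝ :=
  PositiveLinearMap.mk₀
    { toFun := fun f => (⟪v, cfc (fun x : ℝ => f x) T v⟫_ℂ).re
      map_add' := fun f g => by
        simp only [CompactlySupportedContinuousMap.add_apply]
        rw [cfc_add (fun x : ℝ => f x) (fun x : ℝ => g x) (a := T)
          f.continuous.continuousOn g.continuous.continuousOn]
        simp
      map_smul' := fun c f => by
        simp only [CompactlySupportedContinuousMap.smul_apply]
        rw [cfc_smul c (fun x : ℝ => f x) T f.continuous.continuousOn]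
        simp [inner_smul_right_eq_smul] }
    (fun f hf => by
      have h : (0 : H →L[ℂ] H) ≤ cfc (fun x : ℝ => f x) T := cfc_nonneg fun x _ => hf x
      rw [ContinuousLinearMap.nonneg_iff_isPositive] at h
      exact h.re_inner_nonneg_right v)

/-- The scalar spectral measure `⟨E(·) v, v⟩` of the bounded self-adjoint operator `T` at the
vector `v`: the unique regular Borel measure `ρ` on `ℝ` with `∫ f dρ = ⟨f(T) v, v⟩` for all
compactly supported continuous `f`. -/
def spectralMeasure (T : H →L[ℂ] H) (_hT : IsSelfAdjoint T) (v : H) : Measure ℝ :=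
  RealRMK.rieszMeasure (spectralFunctional T v)

theorem integral_spectralMeasure (T : H →L[ℂ] H) (hT : IsSelfAdjoint T) (v : H)
    (f : CompactlySupportedContinuousMap ℝ ℝ) :
    ∫ x, f x ∂(spectralMeasure T hT v) = (⟪v, cfc (fun x : ℝ => f x) T v⟫_ℂ).re :=
  RealRMK.integral_rieszMeasure (spectralFunctional T v) f

end SpectralMeasure

/-- The sequence `c 0, c 1, …, c (N - 1), c N, c N, c N, …`. -/
def stabilize (c : ℕ → ℝ) (N : ℕ) : ℕ → ℝ := fun n => c (min n N)

theorem isBddSeq_stabilize (c : ℕ → ℝ) (N : ℕ) : IsBddSeq (stabilize c N) :=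
  ⟨∑ i ∈ Finset.range (N + 1), |c i|, fun n =>
    Finset.single_le_sum (f := fun i => |c i|) (fun _ _ => abs_nonneg _)
      (Finset.mem_range.2 (Nat.lt_succ_of_le (min_le_right n N)))⟩

/-- The stabilized Jacobi operator `J_N`. -/
def stabilizedOperator (a b : ℕ → ℝ) (N : ℕ) : Space →L[ℂ] Space :=
  operator (stabilize a N) (stabilize b N) (isBddSeq_stabilize a N) (isBddSeq_stabilize b N)

/-- The spectral measure `ρ_N` of `J_N` at the first vector of the standard basis. -/
def stabilizedMeasure (a b : ℕ → ℝ) (N : ℕ) : Measure ℝ :=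
  spectralMeasure (stabilizedOperator a b N) (isSelfAdjoint_operator _ _ _ _)
    (lp.single 2 (0 : ℕ) (1 : ℂ))

/-- The orthogonal polynomials of the first kind: the solution of the eigenvector equation
`b 0 * P 0 + a 0 * P 1 = X * P 0`, `a n * P n + b (n+1) * P (n+1) + a (n+1) * P (n+2) = X * P (n+1)`
with `P 0 = 1`. -/
def poly (a b : ℕ → ℝ) : ℕ → ℝ[X]
  | 0 => 1
  | 1 => C (a 0)⁻¹ * (X - C (b 0))
  | n + 2 => C (a (n + 1))⁻¹ * ((X - C (b (n + 1))) * poly a b (n + 1) - C (a n) * poly a b n)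

/-- `z(x) = w - i √(1 - w²)` with `w = (x - β) / (2 α)`, for real `x`. -/
def boundaryRoot (α β x : ℝ) : ℂ :=
  (((x - β) / (2 * α) : ℝ) : ℂ) - Complex.I * (Real.sqrt (1 - ((x - β) / (2 * α)) ^ 2) : ℂ)

/-- The function `√(1 - w²) / (π a_N |P_{N+1}(x) - z_N(x) P_N(x)|²)`, `w = (x - b_N) / (2 a_N)`. -/
def density (a b : ℕ → ℝ) (N : ℕ) (x : ℝ) : ℝ :=
  Real.sqrt (1 - ((x - b N) / (2 * a N)) ^ 2) /
    (Real.pi * a N *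
      ‖(((poly a b (N + 1)).eval x : ℝ) : ℂ)
        - boundaryRoot (a N) (b N) x * (((poly a b N).eval x : ℝ) : ℂ)‖ ^ 2)

end Jacobi

end

/-!
With `w = (l - b_N) / (2 a_N)` the characteristic equation is `ζ² - 2 w ζ + 1 = 0`. Its roots have
product `1`, so at most one lies in the open disc. The form `w (1 - √(1 - w⁻²))` of that root
(`innerRoot`) is analytic off the whole segment; on the upper half-plane it equals
`w - i √(1 - w²)` (`upperRoot`), which is continuous across the open interval and has the stated
boundary value there.

For `Im l > 0` and a coefficient sequence that is constant from `N` on, a solution of the three-term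
recurrence whose entries at `N` and `N + 1` are in the ratio `z = z_N(l)` is geometric from `N` on,
hence square summable. Applied to `Q + m P`, with `Q` the polynomials of the second kind and
`m = -(Q_{N+1} - z Q_N) / (P_{N+1} - z P_N)`, this gives `(J_N - l)⁻¹ e = Q + m P`, so `m` is the
Weyl function (`exists_resolvent_eq_weyl`). The denominator does not vanish on the upper half-plane,
since otherwise `P` would be an eigenvector of a symmetric operator at a non-real eigenvalue; nor
does it vanish on the open interval, since `Im z ≠ 0` there while `P_N` and `P_{N+1}` have no common
zero. Thus `m` is continuous up to the interval (`continuousOn_weyl`), and the constancy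
of the Wronskian `a_n (Q_{n+1} P_n - Q_n P_{n+1}) = 1` turns `Im m / π` on the interval into the
stated density (`im_weyl`).

The functional calculus identifies `Im m(x + iε)` with the Poisson integral
`∫ ε / ((t - x)² + ε²) dρ_N(t)` (`integral_poissonKernel_spectralMeasure`). Integrating it over
`[c, d]`, exchanging the integrals and letting `ε ↓ 0` gives
`π/2 (ρ_N((c, d]) + ρ_N([c, d)))` by the limits of the arctangent. As the Poisson integral has a
continuous boundary value, `ρ_N` has no atoms in the interval, and `ρ_N((c, d])` is the integral of
`Im m / π` (`measureReal_Ioc_of_poissonIntegral`). The density and the derivative of the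
distribution function follow.
-/

/-! ### The characteristic equation -/

namespace Jacobi

theorem complex_sqrt_sq (u : ℂ) : Complex.sqrt u ^ 2 = u := by
  exact Complex.cpow_nat_inv_pow u two_ne_zero

theorem re_complex_sqrt_pos {u : ℂ} (hu : u ∈ Complex.slitPlane) : 0 < (Complex.sqrt u).re := by
  rw [Complex.sqrt, Complex.cpow_inv_two_re]
  refine Real.sqrt_pos.2 (half_pos ?_)
  rcases hu with h | h
  · positivity
  · have := (abs_lt.1 (Complex.abs_re_lt_norm.2 h)).1
    linarith

theorem analyticAt_complex_sqrt {u : ℂ} (hu : u ∈ Complex.slitPlane) :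
    AnalyticAt ℂ Complex.sqrt u := by
  unfold Complex.sqrt
  exact analyticAt_id.cpow analyticAt_const hu

/-- The root `w (1 - √(1 - w⁻²))` of `ζ² - 2 w ζ + 1 = 0`. With the principal square root this form
is analytic in `w` off the whole segment `[-1, 1]`. -/
noncomputable def innerRoot (w : ℂ) : ℂ := w * (1 - Complex.sqrt (1 - (w ^ 2)⁻¹))

/-- The root `w - i √(1 - w²)` of `ζ² - 2 w ζ + 1 = 0`. With the principal square root this form
is analytic in `w` on the upper half-plane and across the open segment `(-1, 1)`. -/
noncomputable def upperRoot (w : ℂ) : ℂ := w - Complex.I * Complex.sqrt (1 - w ^ 2)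

theorem upperRoot_isRoot (w : ℂ) : upperRoot w ^ 2 - 2 * w * upperRoot w + 1 = 0 := by
  have h := complex_sqrt_sq (1 - w ^ 2)
  unfold upperRoot
  linear_combination (-1 : ℂ) * h + Complex.sqrt (1 - w ^ 2) ^ 2 * Complex.I_sq

theorem innerRoot_isRoot {w : ℂ} (hw : w ≠ 0) :
    innerRoot w ^ 2 - 2 * w * innerRoot w + 1 = 0 := by
  have h := complex_sqrt_sq (1 - (w ^ 2)⁻¹)
  have h2 : w ^ 2 * (w ^ 2)⁻¹ = 1 := mul_inv_cancel₀ (pow_ne_zero 2 hw)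
  unfold innerRoot
  linear_combination w ^ 2 * h - h2

/-- The two roots of `ζ² - 2 w ζ + 1 = 0` have product `1`, so the smaller one lies in the disc. -/
theorem norm_lt_one_of_isRoot {w r : ℂ} (hr : r ^ 2 - 2 * w * r + 1 = 0)
    (h : ‖r‖ < ‖2 * w - r‖) : ‖r‖ < 1 := by
  have h1 : ‖r‖ * ‖2 * w - r‖ = 1 := by
    rw [← norm_mul, ← norm_one (α := ℂ)]
    congr 1
    linear_combination -hr
  nlinarith [norm_nonneg r]

theorem isRoot_and_norm_lt_one_iff {w r : ℂ} (hr : r ^ 2 - 2 * w * r + 1 = 0) (hr1 : ‖r‖ < 1)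
    (ζ : ℂ) : (ζ ^ 2 - 2 * w * ζ + 1 = 0 ∧ ‖ζ‖ < 1) ↔ ζ = r := by
  constructor
  · rintro ⟨h, h1⟩
    have h2 : (ζ - r) * (ζ + r - 2 * w) = 0 := by linear_combination h - hr
    rcases mul_eq_zero.1 h2 with h3 | h3
    · exact sub_eq_zero.1 h3
    · have h4 : ζ * r = 1 := by linear_combination r * h3 - hr
      have h5 : ‖ζ‖ * ‖r‖ = 1 := by rw [← norm_mul, h4, norm_one]
      nlinarith [norm_nonneg r, norm_nonneg ζ]
  · rintro rfl
    exact ⟨hr, hr1⟩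

theorem characteristic_iff {α : ℝ} (hα : 0 < α) (β : ℝ) (l ζ : ℂ) :
    (α : ℂ) * ζ ^ 2 + (β : ℂ) * ζ + (α : ℂ) = l * ζ ↔
      ζ ^ 2 - 2 * ((l - β) / (2 * α)) * ζ + 1 = 0 := by
  have h : (α : ℂ) ≠ 0 := by exact_mod_cast hα.ne'
  have h1 : (α : ℂ) * (ζ ^ 2 - 2 * ((l - β) / (2 * α)) * ζ + 1)
      = (α : ℂ) * ζ ^ 2 + (β : ℂ) * ζ + (α : ℂ) - l * ζ := by
    field_simp
    ring
  rw [← sub_eq_zero, ← h1, mul_eq_zero, or_iff_right h]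

theorem one_sub_inv_sq_mem_slitPlane {w : ℂ} (hw : w ∉ ((↑) : ℝ → ℂ) '' Set.Icc (-1) 1) :
    1 - (w ^ 2)⁻¹ ∈ Complex.slitPlane := by
  by_contra hc
  rw [Complex.mem_slitPlane_iff, not_or, not_lt, not_not] at hc
  -- `w⁻²` is real and at least `1`, so `w²` is a real number in `(0, 1]`
  obtain ⟨t, ht⟩ : ∃ t : ℝ, (w ^ 2)⁻¹ = t :=
    ⟨((w ^ 2)⁻¹).re, Complex.ext rfl (by
      simpa only [Complex.sub_im, Complex.one_im, zero_sub, neg_eq_zero,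
        Complex.ofReal_im] using hc.2)⟩
  have ht1 : 1 ≤ t := by simpa [ht] using hc.1
  have ht0 : 0 < t := by linarith
  apply hw
  have hs : w ^ 2 = ((Real.sqrt t⁻¹ : ℝ) : ℂ) ^ 2 := by
    rw [← Complex.ofReal_pow, Real.sq_sqrt (inv_pos.2 ht0).le, Complex.ofReal_inv, ← ht, inv_inv]
  have hs1 : Real.sqrt t⁻¹ ≤ 1 := Real.sqrt_le_one.2 (inv_le_one_of_one_le₀ ht1)
  have hs0 := Real.sqrt_nonneg t⁻¹
  rcases sq_eq_sq_iff_eq_or_eq_neg.1 hs with h | h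
  · exact ⟨_, ⟨by linarith, hs1⟩, h.symm⟩
  · exact ⟨-Real.sqrt t⁻¹, ⟨by linarith, by linarith⟩, by simp [h]⟩

theorem norm_innerRoot_lt_one {w : ℂ} (hw : w ∉ ((↑) : ℝ → ℂ) '' Set.Icc (-1) 1) :
    ‖innerRoot w‖ < 1 := by
  have hw0 : w ≠ 0 := by
    rintro rfl
    exact hw ⟨0, by norm_num, by simp⟩
  refine norm_lt_one_of_isRoot (innerRoot_isRoot hw0) ?_
  have hs := re_complex_sqrt_pos (one_sub_inv_sq_mem_slitPlane hw)
  set s := Complex.sqrt (1 - (w ^ 2)⁻¹) with hsdef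
  have h1 : 2 * w - innerRoot w = w * (1 + s) := by rw [innerRoot]; ring
  rw [h1, innerRoot, norm_mul, norm_mul]
  refine mul_lt_mul_of_pos_left ?_ (norm_pos_iff.2 hw0)
  rw [← hsdef, ← sq_lt_sq₀ (norm_nonneg _) (norm_nonneg _), Complex.sq_norm, Complex.sq_norm,
    Complex.normSq_apply, Complex.normSq_apply]
  simp
  nlinarith

theorem analyticAt_innerRoot {w : ℂ} (hw : w ∉ ((↑) : ℝ → ℂ) '' Set.Icc (-1) 1) :
    AnalyticAt ℂ innerRoot w := by
  have hw0 : w ≠ 0 := by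
    rintro rfl
    exact hw ⟨0, by norm_num, by simp⟩
  have h1 : AnalyticAt ℂ (fun w : ℂ => 1 - (w ^ 2)⁻¹) w :=
    analyticAt_const.sub ((analyticAt_id.pow 2).inv (pow_ne_zero 2 hw0))
  have h2 := AnalyticAt.comp (f := fun w : ℂ => 1 - (w ^ 2)⁻¹)
    (analyticAt_complex_sqrt (one_sub_inv_sq_mem_slitPlane hw)) h1
  exact analyticAt_id.mul (analyticAt_const.sub h2)

theorem one_sub_sq_mem_slitPlane_of_im_pos {w : ℂ} (hw : 0 < w.im) :
    1 - w ^ 2 ∈ Complex.slitPlane := by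
  rw [Complex.mem_slitPlane_iff]
  by_cases h : w.re = 0
  · left
    simp [pow_two, h]
    positivity
  · right
    simp [pow_two]
    intro h2
    rcases mul_eq_zero.1 (show w.re * w.im = 0 by linarith) with h3 | h3
    · exact h h3
    · exact hw.ne' h3

theorem one_sub_sq_mem_slitPlane_of_real {x : ℝ} (hx : x ∈ Set.Ioo (-1 : ℝ) 1) :
    1 - (x : ℂ) ^ 2 ∈ Complex.slitPlane := by
  rw [Complex.mem_slitPlane_iff]
  left
  rw [← Complex.ofReal_pow]
  simp only [Complex.sub_re, Complex.one_re, Complex.ofReal_re]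
  nlinarith [hx.1, hx.2]

theorem norm_upperRoot_lt_one {w : ℂ} (hw : 0 < w.im) : ‖upperRoot w‖ < 1 := by
  refine norm_lt_one_of_isRoot (upperRoot_isRoot w) ?_
  have hp := re_complex_sqrt_pos (one_sub_sq_mem_slitPlane_of_im_pos hw)
  have hs := complex_sqrt_sq (1 - w ^ 2)
  set s := Complex.sqrt (1 - w ^ 2) with hsdef
  have h1 : 2 * w - upperRoot w = w + Complex.I * s := by rw [upperRoot]; ring
  have him : s.re * s.im = -(w.re * w.im) := by
    have := congrArg Complex.im hs
    simp [pow_two] at this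
    linarith
  -- `‖w + i s‖² - ‖w - i s‖² = 4 Im (w * conj s)`, which is positive after multiplication by `Re s`
  have hkey : 0 < w.im * s.re - w.re * s.im := by
    have : 0 < s.re * (w.im * s.re - w.re * s.im) := by
      have h2 : s.re * (w.im * s.re - w.re * s.im) = w.im * (s.re ^ 2 + w.re ^ 2) := by
        linear_combination -w.re * him
      rw [h2]
      positivity
    exact pos_of_mul_pos_right this hp.le
  rw [h1, upperRoot, ← hsdef, ← sq_lt_sq₀ (norm_nonneg _) (norm_nonneg _), Complex.sq_norm,
    Complex.sq_norm, Complex.normSq_apply, Complex.normSq_apply]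
  simp
  nlinarith

theorem continuousAt_upperRoot {w : ℂ} (hw : 1 - w ^ 2 ∈ Complex.slitPlane) :
    ContinuousAt upperRoot w := by
  have h2 := ContinuousAt.comp (f := fun w : ℂ => 1 - w ^ 2)
    (analyticAt_complex_sqrt hw).continuousAt (by fun_prop)
  exact continuousAt_id.sub (continuousAt_const.mul h2)

theorem innerRoot_eq_upperRoot {w : ℂ} (hw : 0 < w.im) : innerRoot w = upperRoot w := by
  have hw1 : w ∉ ((↑) : ℝ → ℂ) '' Set.Icc (-1) 1 := by
    rintro ⟨x, _, rfl⟩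
    simp at hw
  have hw0 : w ≠ 0 := by
    rintro rfl
    simp at hw
  exact (isRoot_and_norm_lt_one_iff (upperRoot_isRoot w) (norm_upperRoot_lt_one hw) _).1
    ⟨innerRoot_isRoot hw0, norm_innerRoot_lt_one hw1⟩

theorem im_boundaryRoot (α β x : ℝ) :
    (boundaryRoot α β x).im = -Real.sqrt (1 - ((x - β) / (2 * α)) ^ 2) := by
  simp [boundaryRoot, -Complex.ofReal_div]

section Affine

variable {α : ℝ} (hα : 0 < α) (β : ℝ)

include hα

theorem affine_mem_Ioo {x : ℝ} (hx : x ∈ Set.Ioo (β - 2 * α) (β + 2 * α)) :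
    (x - β) / (2 * α) ∈ Set.Ioo (-1 : ℝ) 1 := by
  rw [Set.mem_Ioo, lt_div_iff₀ (by positivity), div_lt_iff₀ (by positivity)]
  constructor <;> linarith [hx.1, hx.2]

theorem affine_notMem_segment {l : ℂ}
    (hl : l ∈ (((↑) : ℝ → ℂ) '' Set.Icc (β - 2 * α) (β + 2 * α))ᶜ) :
    (l - β) / (2 * α) ∉ ((↑) : ℝ → ℂ) '' Set.Icc (-1) 1 := by
  rintro ⟨x, hx, h⟩
  refine hl ⟨β + 2 * α * x, ⟨?_, ?_⟩, ?_⟩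
  · nlinarith [hx.1]
  · nlinarith [hx.2]
  · have h0 : (2 * (α : ℂ)) ≠ 0 := by exact_mod_cast (by positivity : 2 * α ≠ 0)
    rw [eq_div_iff h0] at h
    push_cast
    linear_combination h

theorem affine_im_pos {l : ℂ} (hl : 0 < l.im) : 0 < ((l - β) / (2 * α)).im := by
  have h : (l - β) / (2 * α) = (l - β) / ((2 * α : ℝ) : ℂ) := by push_cast; rfl
  rw [h, Complex.div_ofReal_im]
  simp
  positivity

theorem one_sub_affine_sq_mem_slitPlane {l : ℂ} (hl : 0 ≤ l.im)
    (hre : l.re ∈ Set.Ioo (β - 2 * α) (β + 2 * α)) :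
    1 - ((l - β) / (2 * α)) ^ 2 ∈ Complex.slitPlane := by
  rcases hl.lt_or_eq with h | h
  · exact one_sub_sq_mem_slitPlane_of_im_pos (affine_im_pos hα β h)
  · have h1 : l = (l.re : ℂ) := Complex.ext rfl (by simpa using h.symm)
    rw [h1]
    exact_mod_cast one_sub_sq_mem_slitPlane_of_real (affine_mem_Ioo hα β hre)

theorem upperRoot_affine_ofReal {x : ℝ} (hx : x ∈ Set.Ioo (β - 2 * α) (β + 2 * α)) :
    upperRoot (((x : ℂ) - β) / (2 * α)) = boundaryRoot α β x := by
  have h := affine_mem_Ioo hα β hx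
  have h1 : 0 ≤ 1 - ((x - β) / (2 * α)) ^ 2 := by nlinarith [h.1, h.2]
  have h2 : ((x : ℂ) - β) / (2 * α) = (((x - β) / (2 * α) : ℝ) : ℂ) := by push_cast; rfl
  rw [upperRoot, boundaryRoot, h2, Real.sqrt_eq_rpow, Complex.ofReal_cpow h1, Complex.sqrt]
  norm_num

theorem im_boundaryRoot_neg {x : ℝ} (hx : x ∈ Set.Ioo (β - 2 * α) (β + 2 * α)) :
    (boundaryRoot α β x).im < 0 := by
  have h := affine_mem_Ioo hα β hx
  rw [im_boundaryRoot, neg_lt_zero, Real.sqrt_pos]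
  nlinarith [h.1, h.2]

theorem tendsto_innerRoot_boundaryRoot {x : ℝ} (hx : x ∈ Set.Ioo (β - 2 * α) (β + 2 * α)) :
    Tendsto (fun l : ℂ => innerRoot ((l - β) / (2 * α))) (𝓝[{l : ℂ | 0 < l.im}] (x : ℂ))
      (𝓝 (boundaryRoot α β x)) := by
  rw [← upperRoot_affine_ofReal hα β hx]
  have h : ContinuousAt (fun l : ℂ => upperRoot ((l - β) / (2 * α))) (x : ℂ) :=
    ContinuousAt.comp (f := fun l : ℂ => (l - β) / (2 * α)) (continuousAt_upperRoot
      (one_sub_affine_sq_mem_slitPlane hα β (by simp) (by simpa using hx))) (by fun_prop)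
  refine (h.tendsto.mono_left nhdsWithin_le_nhds).congr' ?_
  filter_upwards [self_mem_nhdsWithin] with l hl
  exact (innerRoot_eq_upperRoot (affine_im_pos hα β hl)).symm

end Affine

/-! ### Solutions of the three-term recurrence -/

/-- The orthogonal polynomials of the second kind: the solution of the three-term recurrence with
`Q 0 = 0` and `Q 1 = (a 0)⁻¹`. -/
noncomputable def secondPoly (a b : ℕ → ℝ) : ℕ → ℝ[X]
  | 0 => 0
  | 1 => C (a 0)⁻¹
  | n + 2 => C (a (n + 1))⁻¹ *
      ((X - C (b (n + 1))) * secondPoly a b (n + 1) - C (a n) * secondPoly a b n)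

/-- Rows `1, 2, …` of the eigenvalue equation at the spectral parameter `l`. -/
def IsSolution (a b : ℕ → ℝ) (l : ℂ) (u : ℕ → ℂ) : Prop :=
  ∀ n, (a n : ℂ) * u n + (b (n + 1) : ℂ) * u (n + 1) + (a (n + 1) : ℂ) * u (n + 2) = l * u (n + 1)

theorem IsSolution.add_const_mul {a b : ℕ → ℝ} {l : ℂ} {u v : ℕ → ℂ} (hu : IsSolution a b l u)
    (hv : IsSolution a b l v) (m : ℂ) : IsSolution a b l fun n => u n + m * v n := fun n => by
  linear_combination hu n + m * hv n

section

variable {a b : ℕ → ℝ} (ha : ∀ n, 0 < a n)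

include ha

theorem isSolution_poly (l : ℂ) : IsSolution a b l fun n => aeval l (poly a b n) := fun n => by
  have h : (a (n + 1) : ℂ) ≠ 0 := by exact_mod_cast (ha (n + 1)).ne'
  simp only [poly, map_mul, map_sub, aeval_X, aeval_C, Complex.coe_algebraMap, Complex.ofReal_inv]
  field_simp
  ring

theorem isSolution_secondPoly (l : ℂ) :
    IsSolution a b l fun n => aeval l (secondPoly a b n) := fun n => by
  have h : (a (n + 1) : ℂ) ≠ 0 := by exact_mod_cast (ha (n + 1)).ne'
  simp only [secondPoly, map_mul, map_sub, aeval_X, aeval_C, Complex.coe_algebraMap,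
    Complex.ofReal_inv]
  field_simp
  ring

/-- Constancy of the Wronskian of the solutions of the second and the first kind. -/
theorem wronskian (l : ℂ) (n : ℕ) :
    (a n : ℂ) * (aeval l (secondPoly a b (n + 1)) * aeval l (poly a b n)
      - aeval l (secondPoly a b n) * aeval l (poly a b (n + 1))) = 1 := by
  induction n with
  | zero =>
    have h : (a 0 : ℂ) ≠ 0 := by exact_mod_cast (ha 0).ne'
    simp [poly, secondPoly, h]
  | succ n ih =>
    have h1 := isSolution_poly (b := b) ha l n
    have h2 := isSolution_secondPoly (b := b) ha l n
    linear_combination ih + aeval l (poly a b (n + 1)) * h2 -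
      aeval l (secondPoly a b (n + 1)) * h1

theorem action_poly (l : ℂ) :
    action a b (fun n => aeval l (poly a b n)) = fun n => l * aeval l (poly a b n) := by
  funext n
  cases n with
  | zero =>
    have h : (a 0 : ℂ) ≠ 0 := by exact_mod_cast (ha 0).ne'
    simp only [action, poly, map_mul, map_sub, map_one, aeval_X, aeval_C, Complex.coe_algebraMap,
      Complex.ofReal_inv]
    field_simp
    ring
  | succ n => exact isSolution_poly ha l n

theorem action_secondPoly_add (l m : ℂ) :
    action a b (fun n => aeval l (secondPoly a b n) + m * aeval l (poly a b n))
      = fun n => l * (aeval l (secondPoly a b n) + m * aeval l (poly a b n))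
          + if n = 0 then 1 else 0 := by
  funext n
  cases n with
  | zero =>
    have h : (a 0 : ℂ) ≠ 0 := by exact_mod_cast (ha 0).ne'
    simp only [action, poly, secondPoly, map_mul, map_sub, map_one, map_zero, aeval_X, aeval_C,
      Complex.coe_algebraMap, Complex.ofReal_inv, if_true]
    field_simp
    ring
  | succ n =>
    simp only [n.succ_ne_zero, if_false, add_zero]
    exact (isSolution_secondPoly ha l).add_const_mul (isSolution_poly ha l) m n

variable {N : ℕ} (haN : ∀ n, N ≤ n → a n = a N) (hbN : ∀ n, N ≤ n → b n = b N)

include haN hbN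

/-- Where the coefficients are constant, a solution starting in the ratio `ζ` of a root of the
characteristic equation is geometric. -/
theorem IsSolution.eq_pow_mul {l ζ : ℂ} {u : ℕ → ℂ} (hu : IsSolution a b l u)
    (hζ : (a N : ℂ) * ζ ^ 2 + (b N : ℂ) * ζ + (a N : ℂ) = l * ζ) (h0 : u (N + 1) = ζ * u N)
    (k : ℕ) : u (N + k) = ζ ^ k * u N := by
  have h : (a N : ℂ) ≠ 0 := by exact_mod_cast (ha N).ne'
  induction k using Nat.strong_induction_on with
  | _ k ih =>
    match k with
    | 0 => simp
    | 1 => simpa using h0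
    | k + 2 =>
      have e := hu (N + k)
      rw [haN (N + k) (by omega), haN (N + k + 1) (by omega), hbN (N + k + 1) (by omega)] at e
      have e1 := ih k (by omega)
      have e2 := ih (k + 1) (by omega)
      rw [← add_assoc] at e2
      rw [e1, e2] at e
      apply mul_left_cancel₀ h
      rw [← add_assoc]
      linear_combination e - ζ ^ k * u N * hζ

theorem IsSolution.summable_sq {l ζ : ℂ} {u : ℕ → ℂ} (hu : IsSolution a b l u)
    (hζ : (a N : ℂ) * ζ ^ 2 + (b N : ℂ) * ζ + (a N : ℂ) = l * ζ) (hζ1 : ‖ζ‖ < 1)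
    (h0 : u (N + 1) = ζ * u N) : Summable fun n => ‖u n‖ ^ 2 := by
  rw [← summable_nat_add_iff N]
  have h : ∀ k, ‖u (k + N)‖ ^ 2 = (‖ζ‖ ^ 2) ^ k * ‖u N‖ ^ 2 := fun k => by
    rw [add_comm, hu.eq_pow_mul ha haN hbN hζ h0, norm_mul, norm_pow]
    ring
  simp_rw [h]
  exact (summable_geometric_of_lt_one (by positivity)
    (by nlinarith [norm_nonneg ζ])).mul_right _

/-- Otherwise the first kind solution would be an eigenvector of a self-adjoint operator at a
non-real eigenvalue. -/
theorem poly_succ_sub_mul_ne_zero_of_im_pos (hA : IsBddSeq a) (hB : IsBddSeq b) {l ζ : ℂ}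
    (hl : 0 < l.im)
    (hζ : (a N : ℂ) * ζ ^ 2 + (b N : ℂ) * ζ + (a N : ℂ) = l * ζ) (hζ1 : ‖ζ‖ < 1) :
    aeval l (poly a b (N + 1)) - ζ * aeval l (poly a b N) ≠ 0 := by
  intro h
  let u : Space := ⟨fun n => aeval l (poly a b n), memlp_of_summable_sq
    ((isSolution_poly ha l).summable_sq ha haN hbN hζ hζ1 (sub_eq_zero.1 h))⟩
  have hu0 : u ≠ 0 := by
    intro h0
    have h1 : (u : ℕ → ℂ) 0 = 0 := by rw [h0]; rfl
    simp [u, poly] at h1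
  have hu : linearOperator a b hA hB u = l • u := by
    apply lp.ext
    exact action_poly ha l
  have hev : Module.End.HasEigenvalue (linearOperator a b hA hB) l :=
    Module.End.hasEigenvalue_of_hasEigenvector
      ⟨Module.End.mem_eigenspace_iff.2 hu, hu0⟩
  have hc := (isSymmetric_linearOperator a b hA hB).conj_eigenvalue_eq_self hev
  exact hl.ne' (Complex.conj_eq_iff_im.1 hc)

omit haN hbN in
/-- At a real point of the open interval the imaginary part of the denominator is a nonzero multiple
of `P N`, and two consecutive `P n` cannot vanish together. -/
theorem poly_succ_sub_mul_ne_zero_of_real {x : ℝ} {ζ : ℂ} (hζ : ζ.im ≠ 0) :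
    aeval (x : ℂ) (poly a b (N + 1)) - ζ * aeval (x : ℂ) (poly a b N) ≠ 0 := by
  intro h
  have hw := wronskian (b := b) ha (x : ℂ) N
  have hr : ∀ n, aeval (x : ℂ) (poly a b n) = (((poly a b n).eval x : ℝ) : ℂ) := fun n =>
    aeval_algebraMap_apply_eq_algebraMap_eval x _
  have h1 : (poly a b N).eval x = 0 := by
    have := congrArg Complex.im h
    simpa [hr, hζ] using this
  have h2 : (poly a b (N + 1)).eval x = 0 := by
    simpa [hr, h1] using h
  simp [hr, h1, h2] at hw

end

/-- The Weyl function `⟨(J - l)⁻¹ e, e⟩` at the first basis vector `e`, for coefficients constant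
from the index `N` on: the number `m` for which the solution `Q + m P` is a multiple of `zⁿ` for
`n ≥ N`. The root is taken in the form continuous up to the open interval. -/
noncomputable def weyl (a b : ℕ → ℝ) (N : ℕ) (l : ℂ) : ℂ :=
  -(aeval l (secondPoly a b (N + 1))
      - upperRoot ((l - b N) / (2 * a N)) * aeval l (secondPoly a b N)) /
    (aeval l (poly a b (N + 1)) - upperRoot ((l - b N) / (2 * a N)) * aeval l (poly a b N))

section

variable {a b : ℕ → ℝ} (ha : ∀ n, 0 < a n) (hA : IsBddSeq a) (hB : IsBddSeq b)
  {N : ℕ} (haN : ∀ n, N ≤ n → a n = a N) (hbN : ∀ n, N ≤ n → b n = b N)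

include ha hA hB haN hbN

/-- On the upper half-plane `Q + m P` is square summable and is the resolvent applied to the first
basis vector. -/
theorem exists_resolvent_eq_weyl {l : ℂ} (hl : 0 < l.im) :
    ∃ u : Space, operator a b hA hB u - l • u = lp.single 2 (0 : ℕ) (1 : ℂ) ∧
      (u : ℕ → ℂ) 0 = weyl a b N l := by
  set ζ := upperRoot ((l - b N) / (2 * a N)) with hζdef
  have hζ := (characteristic_iff (ha N) (b N) l ζ).2 (upperRoot_isRoot _)
  have hζ1 : ‖ζ‖ < 1 := norm_upperRoot_lt_one (affine_im_pos (ha N) (b N) hl)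
  have hD := poly_succ_sub_mul_ne_zero_of_im_pos ha haN hbN hA hB hl hζ hζ1
  have hm : weyl a b N l * (aeval l (poly a b (N + 1)) - ζ * aeval l (poly a b N))
      = -(aeval l (secondPoly a b (N + 1)) - ζ * aeval l (secondPoly a b N)) :=
    div_mul_cancel₀ _ hD
  have hsum := ((isSolution_secondPoly ha l).add_const_mul (isSolution_poly ha l)
    (weyl a b N l)).summable_sq ha haN hbN hζ hζ1 (by linear_combination hm)
  refine ⟨⟨_, memlp_of_summable_sq hsum⟩, ?_, by simp [secondPoly, poly]⟩
  apply lp.ext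
  rw [lp.coeFn_sub, operator_apply]
  funext n
  simp only [Pi.sub_apply, action_secondPoly_add ha, lp.coeFn_smul, Pi.smul_apply, smul_eq_mul,
    lp.single_apply]
  by_cases hn : n = 0
  · subst hn
    simp
  · simp [hn]

theorem continuousOn_weyl :
    ContinuousOn (weyl a b N)
      {l : ℂ | 0 ≤ l.im ∧ l.re ∈ Set.Ioo (b N - 2 * a N) (b N + 2 * a N)} := by
  rintro l ⟨him, hre⟩
  refine ContinuousAt.continuousWithinAt ?_
  have hζ : ContinuousAt (fun l : ℂ => upperRoot ((l - b N) / (2 * a N))) l :=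
    ContinuousAt.comp (f := fun l : ℂ => (l - b N) / (2 * a N)) (continuousAt_upperRoot
      (one_sub_affine_sq_mem_slitPlane (ha N) (b N) him hre)) (by fun_prop)
  have hp : ∀ p : ℝ[X], ContinuousAt (fun l : ℂ => aeval l p) l := fun p =>
    p.continuous_aeval.continuousAt
  refine ContinuousAt.div (((hp _).sub (hζ.mul (hp _))).neg) ((hp _).sub (hζ.mul (hp _))) ?_
  rcases him.lt_or_eq with h | h
  · exact poly_succ_sub_mul_ne_zero_of_im_pos ha haN hbN hA hB h
      ((characteristic_iff (ha N) (b N) l _).2 (upperRoot_isRoot _))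
      (norm_upperRoot_lt_one (affine_im_pos (ha N) (b N) h))
  · have h1 : l = (l.re : ℂ) := Complex.ext rfl (by simpa using h.symm)
    rw [h1]
    refine poly_succ_sub_mul_ne_zero_of_real ha ?_
    rw [upperRoot_affine_ofReal (ha N) (b N) hre]
    exact (im_boundaryRoot_neg (ha N) (b N) hre).ne

end

theorem im_weyl {a b : ℕ → ℝ} (ha : ∀ n, 0 < a n) {N : ℕ} {x : ℝ}
    (hx : x ∈ Set.Ioo (b N - 2 * a N) (b N + 2 * a N)) :
    (weyl a b N x).im / Real.pi = density a b N x := by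
  have hr : ∀ p : ℝ[X], aeval (x : ℂ) p = ((p.eval x : ℝ) : ℂ) := fun p =>
    aeval_algebraMap_apply_eq_algebraMap_eval x _
  have hW := wronskian (b := b) ha (x : ℂ) N
  rw [density, weyl, upperRoot_affine_ofReal (ha N) (b N) hx]
  simp only [hr] at hW ⊢
  norm_cast at hW
  have hD := poly_succ_sub_mul_ne_zero_of_real (b := b) ha (N := N) (x := x)
    (im_boundaryRoot_neg (ha N) (b N) hx).ne
  simp only [hr] at hD
  have hD2 := Complex.normSq_pos.2 hD
  rw [Complex.sq_norm, Complex.div_im]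
  have hN : 0 < a N := ha N
  have hpi := Real.pi_pos
  have hire := im_boundaryRoot (a N) (b N) x
  set Dn := Complex.normSq (((poly a b (N + 1)).eval x : ℝ)
    - boundaryRoot (a N) (b N) x * ((poly a b N).eval x : ℝ))
  set s := Real.sqrt (1 - ((x - b N) / (2 * a N)) ^ 2)
  simp [hire]
  field_simp
  linear_combination s * hW

/-! ### Stieltjes inversion for finite measures on the line -/

theorem continuous_poissonKernel {ε : ℝ} (hε : 0 < ε) :
    Continuous fun p : ℝ × ℝ => ε / ((p.2 - p.1) ^ 2 + ε ^ 2) :=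
  continuous_const.div (by fun_prop) fun p => by positivity

theorem poissonKernel_le {ε : ℝ} (hε : 0 < ε) (x t : ℝ) :
    ‖ε / ((t - x) ^ 2 + ε ^ 2)‖ ≤ ε⁻¹ := by
  rw [Real.norm_of_nonneg (by positivity), div_le_iff₀ (by positivity), inv_mul_eq_div,
    le_div_iff₀ hε]
  nlinarith [sq_nonneg (t - x)]

theorem intervalIntegral_poissonKernel {ε : ℝ} (hε : 0 < ε) (c d t : ℝ) :
    ∫ x in c..d, ε / ((t - x) ^ 2 + ε ^ 2)
      = Real.arctan ((d - t) / ε) - Real.arctan ((c - t) / ε) := by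
  have hd : ∀ x ∈ Set.uIcc c d,
      HasDerivAt (fun x => Real.arctan ((x - t) / ε)) (ε / ((t - x) ^ 2 + ε ^ 2)) x := by
    intro x _
    have h := (((hasDerivAt_id x).sub_const t).div_const ε).arctan
    refine h.congr_deriv ?_
    have h2 : (t - x) ^ 2 + ε ^ 2 ≠ 0 := by positivity
    have h3 : 1 + ((x - t) / ε) ^ 2 ≠ 0 := by positivity
    simp only [id]
    field_simp
    ring
  rw [intervalIntegral.integral_eq_sub_of_hasDerivAt hd]
  refine Continuous.intervalIntegrable ?_ _ _
  exact (continuous_poissonKernel hε).comp (f := fun x : ℝ => (x, t)) (by fun_prop)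

/-- The pointwise limit of `arctan (y / ε)` as `ε ↓ 0`; at `y = 0` it takes the value `0`. -/
theorem tendsto_arctan_div (y : ℝ) :
    Tendsto (fun ε : ℝ => Real.arctan (y / ε)) (𝓝[>] 0)
      (𝓝 (Real.pi / 2 * SignType.sign y)) := by
  rcases lt_trichotomy y 0 with h | rfl | h
  · rw [sign_neg h]
    have h1 : Tendsto (fun ε : ℝ => y / ε) (𝓝[>] 0) atBot :=
      tendsto_inv_nhdsGT_zero.const_mul_atTop_of_neg h
    simpa [Function.comp_def] using (Real.tendsto_arctan_atBot.mono_right nhdsWithin_le_nhds).comp h1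
  · simp
  · rw [sign_pos h]
    have h1 : Tendsto (fun ε : ℝ => y / ε) (𝓝[>] 0) atTop :=
      tendsto_inv_nhdsGT_zero.const_mul_atTop h
    simpa [Function.comp_def] using (Real.tendsto_arctan_atTop.mono_right nhdsWithin_le_nhds).comp h1

theorem integral_sign_sub_sign (ρ : Measure ℝ) [IsFiniteMeasure ρ] {c d : ℝ} (hcd : c < d) :
    ∫ t, (Real.pi / 2 * (SignType.sign (d - t) : ℝ) - Real.pi / 2 * (SignType.sign (c - t) : ℝ)) ∂ρ
      = Real.pi / 2 * (ρ.real (Set.Ioc c d) + ρ.real (Set.Ico c d)) := by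
  have h : ∀ t : ℝ,
      Real.pi / 2 * (SignType.sign (d - t) : ℝ) - Real.pi / 2 * (SignType.sign (c - t) : ℝ)
        = Real.pi / 2 * ((Set.Ioc c d).indicator 1 t + (Set.Ico c d).indicator 1 t) := by
    intro t
    rw [← mul_sub]
    congr 1
    simp only [Set.indicator_apply, Set.mem_Ioc, Set.mem_Ico, Pi.one_apply]
    rcases lt_trichotomy t c with h1 | h1 | h1 <;> rcases lt_trichotomy t d with h2 | h2 | h2 <;>
      simp [sign_apply, *, not_lt.2, not_le.2, le_of_lt]
    all_goals grind
  simp_rw [h]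
  rw [integral_const_mul, integral_add, integral_indicator_one measurableSet_Ioc,
    integral_indicator_one measurableSet_Ico]
  · exact (integrable_const (1 : ℝ)).indicator measurableSet_Ioc
  · exact (integrable_const (1 : ℝ)).indicator measurableSet_Ico

/-- The Poisson integral of a finite measure, integrated over an interval and in the limit `ε ↓ 0`,
counts the interior of the interval fully and each endpoint with weight one half. -/
theorem tendsto_intervalIntegral_poissonIntegral (ρ : Measure ℝ) [IsFiniteMeasure ρ] {c d : ℝ}
    (hcd : c < d) :
    Tendsto (fun ε : ℝ => ∫ x in c..d, ∫ t, ε / ((t - x) ^ 2 + ε ^ 2) ∂ρ) (𝓝[>] 0)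
      (𝓝 (Real.pi / 2 * (ρ.real (Set.Ioc c d) + ρ.real (Set.Ico c d)))) := by
  have h1 : ∀ᶠ ε : ℝ in 𝓝[>] 0,
      ∫ t, (Real.arctan ((d - t) / ε) - Real.arctan ((c - t) / ε)) ∂ρ
        = ∫ x in c..d, ∫ t, ε / ((t - x) ^ 2 + ε ^ 2) ∂ρ := by
    filter_upwards [self_mem_nhdsWithin] with ε (hε : 0 < ε)
    have : IsFiniteMeasure (volume.restrict (Set.uIoc c d)) := ⟨by simp [Set.uIoc]⟩
    rw [intervalIntegral_integral_swap]
    · simp_rw [intervalIntegral_poissonKernel hε]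
    · refine Integrable.of_bound (C := ε⁻¹) ?_ ?_
      · exact (continuous_poissonKernel hε).aestronglyMeasurable
      · exact Eventually.of_forall fun p => poissonKernel_le hε p.1 p.2
  refine Tendsto.congr' h1 ?_
  rw [← integral_sign_sub_sign ρ hcd]
  refine tendsto_integral_filter_of_dominated_convergence (fun _ => Real.pi) ?_ ?_
    (integrable_const _) ?_
  · exact Eventually.of_forall fun ε => by
      refine Continuous.aestronglyMeasurable ?_
      fun_prop
  · refine Eventually.of_forall fun ε => Eventually.of_forall fun t => ?_
    have := Real.arctan_lt_pi_div_two ((d - t) / ε)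
    have := Real.arctan_lt_pi_div_two ((c - t) / ε)
    have := Real.neg_pi_div_two_lt_arctan ((d - t) / ε)
    have := Real.neg_pi_div_two_lt_arctan ((c - t) / ε)
    rw [Real.norm_eq_abs, abs_le]
    constructor <;> linarith
  · exact Eventually.of_forall fun t => (tendsto_arctan_div _).sub (tendsto_arctan_div _)

theorem tendsto_intervalIntegral_of_continuousOn_im_nonneg {F : ℂ → ℝ} {α β c d : ℝ} (hcd : c < d)
    (hF : ContinuousOn F {l : ℂ | 0 ≤ l.im ∧ l.re ∈ Set.Ioo α β}) (hc : α < c) (hd : d < β) :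
    Tendsto (fun ε : ℝ => ∫ x in c..d, F ⟨x, ε⟩) (𝓝[>] 0) (𝓝 (∫ x in c..d, F x)) := by
  have hmk : Continuous fun p : ℝ × ℝ => (⟨p.1, p.2⟩ : ℂ) :=
    Complex.equivRealProdCLM.symm.continuous
  have hG : ContinuousOn (fun p : ℝ × ℝ => F ⟨p.1, p.2⟩) (Set.Icc c d ×ˢ Set.Icc (0 : ℝ) 1) := by
    refine hF.comp hmk.continuousOn fun p hp => ?_
    exact ⟨hp.2.1, hc.trans_le hp.1.1, hp.1.2.trans_lt hd⟩
  obtain ⟨C, hC⟩ := (isCompact_Icc.prod isCompact_Icc).exists_bound_of_continuousOn hG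
  have hev : ∀ᶠ ε : ℝ in 𝓝[>] 0, ε ∈ Set.Ioc (0 : ℝ) 1 := Ioc_mem_nhdsGT one_pos
  refine intervalIntegral.tendsto_integral_filter_of_dominated_convergence (fun _ => C) ?_ ?_
    intervalIntegrable_const ?_
  · filter_upwards [hev] with ε hε
    rw [Set.uIoc_of_le hcd.le]
    refine ContinuousOn.aestronglyMeasurable ?_ measurableSet_Ioc
    refine hG.comp (f := fun x : ℝ => (x, ε)) (by fun_prop) fun x hx => ?_
    exact ⟨Set.Ioc_subset_Icc_self hx, hε.1.le, hε.2⟩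
  · filter_upwards [hev] with ε hε
    refine Eventually.of_forall fun x hx => ?_
    rw [Set.uIoc_of_le hcd.le] at hx
    exact hC (x, ε) ⟨Set.Ioc_subset_Icc_self hx, hε.1.le, hε.2⟩
  · refine Eventually.of_forall fun x hx => ?_
    rw [Set.uIoc_of_le hcd.le] at hx
    have h0 := hG (x, 0) ⟨Set.Ioc_subset_Icc_self hx, le_rfl, zero_le_one⟩
    have h1 : Tendsto (fun ε : ℝ => (x, ε)) (𝓝[>] 0)
        (𝓝[Set.Icc c d ×ˢ Set.Icc (0 : ℝ) 1] (x, 0)) := by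
      refine tendsto_nhdsWithin_iff.2 ⟨?_, ?_⟩
      · exact (Continuous.tendsto (f := fun ε : ℝ => (x, ε)) (by fun_prop) 0).mono_left
          nhdsWithin_le_nhds
      · filter_upwards [hev] with ε hε
        exact ⟨Set.Ioc_subset_Icc_self hx, hε.1.le, hε.2⟩
    exact h0.tendsto.comp h1

section Inversion

variable {ρ : Measure ℝ} [IsFiniteMeasure ρ] {F : ℂ → ℝ} {α β : ℝ}

theorem measureReal_Ioc_add_Ico_of_poissonIntegral
    (hF : ContinuousOn F {l : ℂ | 0 ≤ l.im ∧ l.re ∈ Set.Ioo α β})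
    (hρ : ∀ x ε : ℝ, 0 < ε → ∫ t, ε / ((t - x) ^ 2 + ε ^ 2) ∂ρ = F ⟨x, ε⟩)
    {c d : ℝ} (hcd : c < d) (hc : α < c) (hd : d < β) :
    ρ.real (Set.Ioc c d) + ρ.real (Set.Ico c d) = 2 * ∫ x in c..d, F x / Real.pi := by
  have h1 := tendsto_intervalIntegral_poissonIntegral ρ hcd
  have h2 := tendsto_intervalIntegral_of_continuousOn_im_nonneg hcd hF hc hd
  have h3 := tendsto_nhds_unique (h1.congr' (by
    filter_upwards [self_mem_nhdsWithin] with ε (hε : 0 < ε)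
    simp_rw [fun x => hρ x ε hε])) h2
  rw [intervalIntegral.integral_div, ← h3]
  field_simp

theorem continuousOn_boundary (hF : ContinuousOn F {l : ℂ | 0 ≤ l.im ∧ l.re ∈ Set.Ioo α β}) :
    ContinuousOn (fun x : ℝ => F x / Real.pi) (Set.Ioo α β) :=
  (hF.comp Complex.continuous_ofReal.continuousOn fun x hx => by simpa using hx).div_const _

theorem intervalIntegrable_boundary
    (hF : ContinuousOn F {l : ℂ | 0 ≤ l.im ∧ l.re ∈ Set.Ioo α β}) {c d : ℝ}
    (hc : c ∈ Set.Ioo α β) (hd : d ∈ Set.Ioo α β) :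
    IntervalIntegrable (fun x : ℝ => F x / Real.pi) volume c d :=
  ((continuousOn_boundary hF).mono
    (Set.ordConnected_Ioo.uIcc_subset hc hd)).intervalIntegrable

/-- A bounded boundary value of the Poisson integral rules out atoms. -/
theorem measureReal_singleton_of_poissonIntegral
    (hF : ContinuousOn F {l : ℂ | 0 ≤ l.im ∧ l.re ∈ Set.Ioo α β})
    (hρ : ∀ x ε : ℝ, 0 < ε → ∫ t, ε / ((t - x) ^ 2 + ε ^ 2) ∂ρ = F ⟨x, ε⟩)
    {x : ℝ} (hx : x ∈ Set.Ioo α β) : ρ.real {x} = 0 := by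
  obtain ⟨c, hc, hcx⟩ := exists_between hx.1
  have hcm : c ∈ Set.Ioo α β := ⟨hc, hcx.trans hx.2⟩
  have hlim : Tendsto (fun y => 2 * ∫ t in y..x, F t / Real.pi) (𝓝[<] x) (𝓝 0) := by
    have h := (intervalIntegral.integral_hasDerivAt_left (b := x)
      (intervalIntegrable_boundary hF hx hx)
      ((continuousOn_boundary hF).stronglyMeasurableAtFilter isOpen_Ioo x hx)
      ((continuousOn_boundary hF).continuousAt (isOpen_Ioo.mem_nhds hx))).continuousAt.tendsto
    simpa using (h.mono_left nhdsWithin_le_nhds).const_mul 2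
  refine le_antisymm (ge_of_tendsto hlim ?_) measureReal_nonneg
  filter_upwards [Ioo_mem_nhdsLT hcx] with y hy
  rw [← measureReal_Ioc_add_Ico_of_poissonIntegral hF hρ hy.2 (hc.trans hy.1) hx.2]
  have h1 : ρ.real {x} ≤ ρ.real (Set.Ioc y x) :=
    measureReal_mono (by simpa using hy.2)
  have := measureReal_nonneg (μ := ρ) (s := Set.Ico y x)
  linarith

theorem measureReal_Ioc_of_poissonIntegral
    (hF : ContinuousOn F {l : ℂ | 0 ≤ l.im ∧ l.re ∈ Set.Ioo α β})
    (hρ : ∀ x ε : ℝ, 0 < ε → ∫ t, ε / ((t - x) ^ 2 + ε ^ 2) ∂ρ = F ⟨x, ε⟩)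
    {c d : ℝ} (hcd : c < d) (hc : α < c) (hd : d < β) :
    ρ.real (Set.Ioc c d) = ∫ x in c..d, F x / Real.pi := by
  have h := measureReal_Ioc_add_Ico_of_poissonIntegral hF hρ hcd hc hd
  have h0 : ∀ x ∈ Set.Ioo α β, ρ {x} = 0 := fun x hx =>
    (measureReal_eq_zero_iff).1 (measureReal_singleton_of_poissonIntegral hF hρ hx)
  have h1 : ρ (Set.Ioc c d) = ρ (Set.Ioo c d) :=
    (measure_congr (Ioo_ae_eq_Ioc' (h0 d ⟨hc.trans hcd, hd⟩))).symm
  have h2 : ρ (Set.Ico c d) = ρ (Set.Ioo c d) :=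
    (measure_congr (Ioo_ae_eq_Ico' (h0 c ⟨hc, hcd.trans hd⟩))).symm
  have h3 : ρ.real (Set.Ioc c d) = ρ.real (Set.Ico c d) := by simp only [measureReal_def, h1, h2]
  linarith

theorem measure_Ioc_of_poissonIntegral
    (hF : ContinuousOn F {l : ℂ | 0 ≤ l.im ∧ l.re ∈ Set.Ioo α β})
    (hρ : ∀ x ε : ℝ, 0 < ε → ∫ t, ε / ((t - x) ^ 2 + ε ^ 2) ∂ρ = F ⟨x, ε⟩)
    (hF0 : ∀ x ∈ Set.Ioo α β, 0 ≤ F x)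
    {c d : ℝ} (hcd : c < d) (hc : α < c) (hd : d < β) :
    ρ (Set.Ioc c d)
      = (volume.withDensity fun x : ℝ => ENNReal.ofReal (F x / Real.pi)) (Set.Ioc c d) := by
  have hi := intervalIntegrable_boundary hF (c := c) (d := d) ⟨hc, hcd.trans hd⟩
    ⟨hc.trans hcd, hd⟩
  rw [withDensity_apply _ measurableSet_Ioc, ← ofReal_integral_eq_lintegral_ofReal
    ((intervalIntegrable_iff_integrableOn_Ioc_of_le hcd.le).1 hi),
    ← intervalIntegral.integral_of_le hcd.le, ← measureReal_Ioc_of_poissonIntegral hF hρ hcd hc hd,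
    ofReal_measureReal]
  refine (ae_restrict_iff' measurableSet_Ioc).2 (Eventually.of_forall fun x hx => ?_)
  exact div_nonneg (hF0 x ⟨hc.trans hx.1, hx.2.trans_lt hd⟩) Real.pi_pos.le

/-- Stieltjes inversion: where the Poisson integral of `ρ` extends continuously to a real interval,
`ρ` has there the density given by the boundary value divided by `π`. -/
theorem restrict_eq_withDensity_of_poissonIntegral
    (hF : ContinuousOn F {l : ℂ | 0 ≤ l.im ∧ l.re ∈ Set.Ioo α β})
    (hρ : ∀ x ε : ℝ, 0 < ε → ∫ t, ε / ((t - x) ^ 2 + ε ^ 2) ∂ρ = F ⟨x, ε⟩)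
    (hF0 : ∀ x ∈ Set.Ioo α β, 0 ≤ F x) :
    ρ.restrict (Set.Ioo α β)
      = (volume.restrict (Set.Ioo α β)).withDensity
          fun x : ℝ => ENNReal.ofReal (F x / Real.pi) := by
  rw [← restrict_withDensity measurableSet_Ioo]
  -- the interval is exhausted by countably many half-open intervals `(c, d]` with `α < c`, `d < β`
  have hU : Set.Ioo α β
      = ⋃ p : {p : ℚ × ℚ // α < p.1 ∧ (p.2 : ℝ) < β}, Set.Ioc (p.1.1 : ℝ) (p.1.2 : ℝ) := by
    ext x
    simp only [Set.mem_iUnion, Subtype.exists, Set.mem_Ioc, Prod.exists]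
    constructor
    · rintro ⟨h1, h2⟩
      obtain ⟨q, hq1, hq2⟩ := exists_rat_btwn h1
      obtain ⟨r, hr1, hr2⟩ := exists_rat_btwn h2
      exact ⟨q, r, ⟨hq1, hr2⟩, hq2, hr1.le⟩
    · rintro ⟨q, r, ⟨h1, h2⟩, h3, h4⟩
      exact ⟨h1.trans h3, h4.trans_lt h2⟩
  rw [hU, Measure.restrict_iUnion_congr]
  rintro ⟨⟨q, r⟩, hq, hr⟩
  refine Measure.ext_of_Ioc _ _ fun c d _ => ?_
  rw [Measure.restrict_apply measurableSet_Ioc, Measure.restrict_apply measurableSet_Ioc,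
    Set.Ioc_inter_Ioc]
  rcases lt_or_ge (c ⊔ (q : ℝ)) (d ⊓ (r : ℝ)) with h | h
  · exact measure_Ioc_of_poissonIntegral hF hρ hF0 h (lt_sup_of_lt_right hq)
      (inf_lt_of_right_lt hr)
  · simp [Set.Ioc_eq_empty (not_lt.2 h)]

theorem hasDerivAt_measureReal_Iic_of_poissonIntegral
    (hF : ContinuousOn F {l : ℂ | 0 ≤ l.im ∧ l.re ∈ Set.Ioo α β})
    (hρ : ∀ x ε : ℝ, 0 < ε → ∫ t, ε / ((t - x) ^ 2 + ε ^ 2) ∂ρ = F ⟨x, ε⟩)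
    {x : ℝ} (hx : x ∈ Set.Ioo α β) :
    HasDerivAt (fun t : ℝ => ρ.real (Set.Iic t)) (F x / Real.pi) x := by
  obtain ⟨c, hc, hcx⟩ := exists_between hx.1
  have h := intervalIntegral.integral_hasDerivAt_right (a := c)
    (intervalIntegrable_boundary hF ⟨hc, hcx.trans hx.2⟩ hx)
    ((continuousOn_boundary hF).stronglyMeasurableAtFilter isOpen_Ioo x hx)
    ((continuousOn_boundary hF).continuousAt (isOpen_Ioo.mem_nhds hx))
  refine (h.const_add (ρ.real (Set.Iic c))).congr_of_eventuallyEq ?_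
  filter_upwards [Ioo_mem_nhds hcx hx.2] with t ht
  rw [← measureReal_Ioc_of_poissonIntegral hF hρ ht.1 hc ht.2,
    ← measureReal_union (Set.Iic_disjoint_Ioc le_rfl) measurableSet_Ioc,
    Set.Iic_union_Ioc_eq_Iic ht.1.le]

end Inversion

/-! ### The spectral measure and its Poisson integral -/

/-- The trapezoidal cutoff: `1` on `[-n, n]`, `0` off `[-(n + 1), n + 1]`, and linear in between. -/
noncomputable def cutoff (n : ℕ) (t : ℝ) : ℝ := max 0 (min 1 (n + 1 - |t|))

theorem continuous_cutoff (n : ℕ) : Continuous (cutoff n) := by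
  unfold cutoff
  fun_prop

theorem cutoff_nonneg (n : ℕ) (t : ℝ) : 0 ≤ cutoff n t := le_max_left _ _

theorem cutoff_le_one (n : ℕ) (t : ℝ) : cutoff n t ≤ 1 := max_le zero_le_one (min_le_left _ _)

theorem cutoff_eq_one {n : ℕ} {t : ℝ} (h : |t| ≤ n) : cutoff n t = 1 := by
  rw [cutoff, min_eq_left (by linarith), max_eq_right zero_le_one]

theorem cutoff_eq_zero {n : ℕ} {t : ℝ} (h : (n : ℝ) + 1 ≤ |t|) : cutoff n t = 0 :=
  max_eq_left ((min_le_right _ _).trans (by linarith))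

/-- The product of a continuous function with a cutoff, as a compactly supported function. -/
noncomputable def cutoffMul (g : ℝ → ℝ) (hg : Continuous g) (n : ℕ) :
    CompactlySupportedContinuousMap ℝ ℝ where
  toFun t := g t * cutoff n t
  continuous_toFun := hg.mul (continuous_cutoff n)
  hasCompactSupport' := by
    refine HasCompactSupport.intro (isCompact_closedBall (0 : ℝ) (n + 1)) fun t ht => ?_
    rw [Metric.mem_closedBall, Real.dist_0_eq_abs, not_le] at ht
    simp [cutoff_eq_zero ht.le]

section Spectral

variable {H : Type*} [NormedAddCommGroup H] [InnerProductSpace ℂ H] [CompleteSpace H]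

/-- Since the spectrum is bounded, the cutoffs are eventually invisible to the calculus. -/
theorem eventually_integral_cutoffMul (T : H →L[ℂ] H) (hT : IsSelfAdjoint T) (v : H) {g : ℝ → ℝ}
    (hg : Continuous g) :
    ∀ᶠ n : ℕ in atTop, ∫ t, g t * cutoff n t ∂(spectralMeasure T hT v)
      = (⟪v, cfc g T v⟫_ℂ).re := by
  obtain ⟨R, hR⟩ := (spectrum.isCompact (𝕜 := ℝ) T).isBounded.exists_norm_le
  filter_upwards [eventually_ge_atTop ⌈R⌉₊] with n hn
  refine (integral_spectralMeasure T hT v (cutoffMul g hg n)).trans ?_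
  have h : cfc (fun t : ℝ => cutoffMul g hg n t) T = cfc g T := by
    refine cfc_congr fun t ht => ?_
    change g t * cutoff n t = g t
    rw [cutoff_eq_one, mul_one]
    exact (hR t ht).trans ((Nat.le_ceil R).trans (by exact_mod_cast hn))
  rw [h]

instance regular_spectralMeasure (T : H →L[ℂ] H) (hT : IsSelfAdjoint T) (v : H) :
    (spectralMeasure T hT v).Regular := by
  unfold spectralMeasure
  infer_instance

theorem isFiniteMeasure_spectralMeasure (T : H →L[ℂ] H) (hT : IsSelfAdjoint T) (v : H) :
    IsFiniteMeasure (spectralMeasure T hT v) := by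
  set ρ := spectralMeasure T hT v
  set C := (⟪v, cfc (fun _ : ℝ => (1 : ℝ)) T v⟫_ℂ).re
  have hmono : Monotone fun n : ℕ => Metric.closedBall (0 : ℝ) n := fun m n hmn =>
    Metric.closedBall_subset_closedBall (by exact_mod_cast hmn)
  have hlim := tendsto_measure_iUnion_atTop (μ := ρ) hmono
  rw [Metric.iUnion_closedBall_nat] at hlim
  have hle : ρ Set.univ ≤ ENNReal.ofReal C := by
    refine le_of_tendsto hlim ?_
    filter_upwards [eventually_integral_cutoffMul T hT v (g := fun _ => (1 : ℝ)) continuous_const]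
      with n hn
    have hfin : ρ (Metric.closedBall (0 : ℝ) n) ≠ ∞ :=
      (isCompact_closedBall (0 : ℝ) n).measure_lt_top.ne
    change ρ (Metric.closedBall (0 : ℝ) n) ≤ _
    rw [← ENNReal.ofReal_toReal hfin]
    refine ENNReal.ofReal_le_ofReal ?_
    change ρ.real (Metric.closedBall (0 : ℝ) n) ≤ C
    refine le_of_le_of_eq ?_ hn
    rw [← integral_indicator_one Metric.isClosed_closedBall.measurableSet]
    refine integral_mono_of_nonneg (Eventually.of_forall fun t =>
      Set.indicator_nonneg (fun _ _ => zero_le_one) t)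
      ((cutoffMul (fun _ => (1 : ℝ)) continuous_const n).integrable)
      (Eventually.of_forall fun t => ?_)
    by_cases ht : t ∈ Metric.closedBall (0 : ℝ) n
    · rw [Metric.mem_closedBall, Real.dist_0_eq_abs] at ht
      simp [ht, cutoff_eq_one ht]
    · simpa [ht] using cutoff_nonneg n t
  exact ⟨hle.trans_lt ENNReal.ofReal_lt_top⟩

theorem integral_spectralMeasure_of_bounded (T : H →L[ℂ] H) (hT : IsSelfAdjoint T) (v : H)
    {g : ℝ → ℝ} (hg : Continuous g) {C : ℝ} (hC : ∀ t, ‖g t‖ ≤ C) :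
    ∫ t, g t ∂(spectralMeasure T hT v) = (⟪v, cfc g T v⟫_ℂ).re := by
  have := isFiniteMeasure_spectralMeasure T hT v
  have h1 : Tendsto (fun n : ℕ => ∫ t, g t * cutoff n t ∂(spectralMeasure T hT v)) atTop
      (𝓝 (∫ t, g t ∂(spectralMeasure T hT v))) := by
    refine tendsto_integral_of_dominated_convergence (fun _ => C) (fun n => ?_)
      (integrable_const _) (fun n => Eventually.of_forall fun t => ?_)
      (Eventually.of_forall fun t => ?_)
    · exact (hg.mul (continuous_cutoff n)).aestronglyMeasurable
    · rw [norm_mul, Real.norm_of_nonneg (cutoff_nonneg n t)]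
      exact (mul_le_of_le_one_right (norm_nonneg _) (cutoff_le_one n t)).trans (hC t)
    · refine tendsto_const_nhds.congr' ?_
      filter_upwards [eventually_ge_atTop ⌈|t|⌉₊] with n hn
      rw [cutoff_eq_one ((Nat.le_ceil _).trans (by exact_mod_cast hn)), mul_one]
  exact tendsto_nhds_unique h1
    (tendsto_const_nhds.congr' ((eventually_integral_cutoffMul T hT v hg).mono fun _ h => h.symm))

theorem isProbabilityMeasure_spectralMeasure (T : H →L[ℂ] H) (hT : IsSelfAdjoint T) {v : H}
    (hv : ‖v‖ = 1) : IsProbabilityMeasure (spectralMeasure T hT v) := by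
  have := isFiniteMeasure_spectralMeasure T hT v
  have h := integral_spectralMeasure_of_bounded T hT v (g := fun _ => (1 : ℝ)) continuous_const
    (C := 1) (by simp)
  rw [cfc_const_one ℝ T] at h
  simp [hv] at h
  exact ⟨by rw [← ENNReal.ofReal_one, ← h, ofReal_measureReal]⟩

/-- If `u = (T - (x + iε))⁻¹ v`, then `ε ((T - x)² + ε²)⁻¹` has the quadratic form `ε ‖u‖²` at `v`,
which equals `Im ⟨v, u⟩` because `T` is symmetric. -/
theorem integral_poissonKernel_spectralMeasure (T : H →L[ℂ] H) (hT : IsSelfAdjoint T) {u v : H}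
    {x ε : ℝ} (hε : 0 < ε) (hu : T u - (⟨x, ε⟩ : ℂ) • u = v) :
    ∫ t, ε / ((t - x) ^ 2 + ε ^ 2) ∂(spectralMeasure T hT v) = (⟪v, u⟫_ℂ).im := by
  have hne : ∀ t : ℝ, (t - x) ^ 2 + ε ^ 2 ≠ 0 := fun t => by positivity
  have hcont : Continuous fun t : ℝ => ε / ((t - x) ^ 2 + ε ^ 2) :=
    (continuous_poissonKernel hε).comp (f := fun t : ℝ => (x, t)) (by fun_prop)
  rw [integral_spectralMeasure_of_bounded T hT v hcont (poissonKernel_le hε x)]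
  set G := cfc (fun t : ℝ => ε / ((t - x) ^ 2 + ε ^ 2)) T with hG
  set S := cfc (fun t : ℝ => t - x) T with hS
  have hST : ∀ w : H, S w = T w - (x : ℂ) • w := by
    intro w
    have h : S = T - algebraMap ℝ (H →L[ℂ] H) x := by
      rw [hS, cfc_sub (fun t : ℝ => t) (fun _ => x) T, cfc_id' ℝ T, cfc_const x T]
    rw [h]
    simp [Algebra.algebraMap_eq_smul_one]
  have hSsym : ∀ w w' : H, ⟪S w, w'⟫_ℂ = ⟪w, S w'⟫_ℂ :=
    ContinuousLinearMap.isSelfAdjoint_iff_isSymmetric.1 (cfc_predicate _ T)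
  have hcomm : ∀ w : H, S (G w) = G (S w) := fun w =>
    congrArg (fun A : H →L[ℂ] H => A w) (cfc_commute_cfc (fun t : ℝ => t - x)
      (fun t : ℝ => ε / ((t - x) ^ 2 + ε ^ 2)) T).eq
  have hinv : ∀ w : H, G (S (S w)) + (ε ^ 2 : ℂ) • G w = (ε : ℂ) • w := by
    intro w
    have h : G * (S * S) + (ε ^ 2) • G = algebraMap ℝ (H →L[ℂ] H) ε := by
      rw [hS, ← cfc_mul (fun t : ℝ => t - x) (fun t : ℝ => t - x) T, hG,
        ← cfc_mul (fun t : ℝ => ε / ((t - x) ^ 2 + ε ^ 2)) (fun t : ℝ => (t - x) * (t - x)) T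
          hcont.continuousOn, ← cfc_smul (ε ^ 2) (fun t : ℝ => ε / ((t - x) ^ 2 + ε ^ 2)) T
          hcont.continuousOn,
        ← cfc_add (fun t : ℝ => ε / ((t - x) ^ 2 + ε ^ 2) * ((t - x) * (t - x)))
          (fun t : ℝ => ε ^ 2 • (ε / ((t - x) ^ 2 + ε ^ 2))) (a := T)
          (hcont.mul (by fun_prop)).continuousOn (hcont.const_smul (ε ^ 2)).continuousOn,
        ← cfc_const ε T]
      refine cfc_congr fun t _ => ?_
      have := hne t
      simp only [smul_eq_mul]
      field_simp
    have h1 := congrArg (fun A : H →L[ℂ] H => A w) h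
    simp [Algebra.algebraMap_eq_smul_one] at h1
    have h2 : ∀ (r : ℝ) (y : H), (r : ℂ) • y = r • y := fun r y => Complex.coe_smul r y
    rw [← Complex.ofReal_pow, h2, h2]
    exact h1
  have hz : (⟨x, ε⟩ : ℂ) = x + ε * Complex.I := by
    apply Complex.ext <;> simp
  have hv : v = S u - (ε * Complex.I : ℂ) • u := by
    rw [← hu, hST, hz, add_smul]
    abel
  have hnorm : ⟪v, G v⟫_ℂ = ε * ⟪u, u⟫_ℂ := by
    have e1 : S (G v) + (ε * Complex.I : ℂ) • G v = (ε : ℂ) • u := by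
      rw [← hinv u, hcomm, hv]
      simp only [map_sub, map_smul, smul_sub, smul_smul]
      have : (ε * Complex.I : ℂ) * (ε * Complex.I) = -(ε ^ 2 : ℂ) := by
        linear_combination (ε : ℂ) ^ 2 * Complex.I_mul_I
      rw [this, neg_smul]
      abel
    calc ⟪v, G v⟫_ℂ = ⟪S u - (ε * Complex.I : ℂ) • u, G v⟫_ℂ := by rw [← hv]
      _ = ⟪u, S (G v) + (ε * Complex.I : ℂ) • G v⟫_ℂ := by
        rw [inner_sub_left, inner_add_right, hSsym, inner_smul_left, inner_smul_right]
        simp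
      _ = ε * ⟪u, u⟫_ℂ := by rw [e1, inner_smul_right]
  have him : ⟪v, u⟫_ℂ = ⟪u, S u⟫_ℂ + (ε * Complex.I : ℂ) * ⟪u, u⟫_ℂ := by
    rw [hv, inner_sub_left, hSsym, inner_smul_left]
    simp
  have hreal : (⟪u, S u⟫_ℂ).im = 0 := by
    rw [← Complex.conj_eq_iff_im, inner_conj_symm, hSsym]
  rw [hnorm, him]
  simp [hreal]

end Spectral

/-! ### Stabilized Jacobi operators -/

theorem stabilize_of_le (c : ℕ → ℝ) {n N : ℕ} (h : n ≤ N) : stabilize c N n = c n := by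
  rw [stabilize, min_eq_left h]

theorem stabilize_of_ge (c : ℕ → ℝ) {n N : ℕ} (h : N ≤ n) :
    stabilize c N n = stabilize c N N := by
  rw [stabilize, stabilize, min_eq_right h, min_self]

/-- `P n` involves only the coefficients with indices below `n`. -/
theorem poly_stabilize (a b : ℕ → ℝ) (N : ℕ) :
    ∀ n, n ≤ N + 1 → poly (stabilize a N) (stabilize b N) n = poly a b n
  | 0, _ => rfl
  | 1, _ => by
    rw [poly, poly, stabilize_of_le a N.zero_le, stabilize_of_le b N.zero_le]
  | n + 2, h => by
    rw [poly, poly, poly_stabilize a b N n (by omega), poly_stabilize a b N (n + 1) (by omega),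
      stabilize_of_le a (by omega : n ≤ N), stabilize_of_le a (by omega : n + 1 ≤ N),
      stabilize_of_le b (by omega : n + 1 ≤ N)]

theorem density_stabilize (a b : ℕ → ℝ) (N : ℕ) :
    density (stabilize a N) (stabilize b N) N = density a b N := by
  funext x
  rw [density, density, poly_stabilize a b N _ le_rfl, poly_stabilize a b N _ N.le_succ,
    stabilize_of_le a le_rfl, stabilize_of_le b le_rfl]

section

variable {a : ℕ → ℝ} (ha : ∀ n, 0 < a n) (b : ℕ → ℝ) (N : ℕ)

include ha

theorem continuousOn_im_weyl_stabilize :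
    ContinuousOn (fun l => (weyl (stabilize a N) (stabilize b N) N l).im)
      {l : ℂ | 0 ≤ l.im ∧ l.re ∈ Set.Ioo (b N - 2 * a N) (b N + 2 * a N)} := by
  have h := continuousOn_weyl (a := stabilize a N) (b := stabilize b N) (N := N)
    (fun n => ha _) (isBddSeq_stabilize a N) (isBddSeq_stabilize b N)
    (fun _ => stabilize_of_ge a) (fun _ => stabilize_of_ge b)
  rw [stabilize_of_le a le_rfl, stabilize_of_le b le_rfl] at h
  exact Complex.continuous_im.comp_continuousOn h

theorem integral_poissonKernel_stabilizedMeasure (x ε : ℝ) (hε : 0 < ε) :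
    ∫ t, ε / ((t - x) ^ 2 + ε ^ 2) ∂(stabilizedMeasure a b N)
      = (weyl (stabilize a N) (stabilize b N) N ⟨x, ε⟩).im := by
  obtain ⟨u, hu, hu0⟩ := exists_resolvent_eq_weyl (a := stabilize a N) (b := stabilize b N)
    (N := N) (l := ⟨x, ε⟩) (fun n => ha _) (isBddSeq_stabilize a N) (isBddSeq_stabilize b N)
    (fun _ => stabilize_of_ge a) (fun _ => stabilize_of_ge b) hε
  have h := integral_poissonKernel_spectralMeasure (stabilizedOperator a b N)
    (isSelfAdjoint_operator _ _ _ _) hε hu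
  refine h.trans ?_
  rw [lp.inner_single_left, hu0]
  simp

theorem im_weyl_stabilize {x : ℝ} (hx : x ∈ Set.Ioo (b N - 2 * a N) (b N + 2 * a N)) :
    (weyl (stabilize a N) (stabilize b N) N x).im / Real.pi = density a b N x := by
  rw [← density_stabilize]
  refine im_weyl (a := stabilize a N) (fun n => ha _) ?_
  rwa [stabilize_of_le a le_rfl, stabilize_of_le b le_rfl]

theorem density_nonneg (x : ℝ) : 0 ≤ density a b N x := by
  have := (ha N).le
  unfold density
  positivity

end

theorem isProbabilityMeasure_stabilizedMeasure (a b : ℕ → ℝ) (N : ℕ) :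
    IsProbabilityMeasure (stabilizedMeasure a b N) :=
  isProbabilityMeasure_spectralMeasure _ _ (by rw [lp.norm_single (by norm_num), norm_one])

end Jacobi

theorem mainTheorem3 (a b : ℕ → ℝ) (ha : ∀ n, 0 < a n) (N : ℕ) :
    -- `z_N`: the analytic branch with modulus less than one, and its boundary values
    (∃ z : ℂ → ℂ,
      AnalyticOnNhd ℂ z
        (((↑) : ℝ → ℂ) '' Set.Icc (b N - 2 * a N) (b N + 2 * a N))ᶜ ∧
      (∀ l ∈ (((↑) : ℝ → ℂ) '' Set.Icc (b N - 2 * a N) (b N + 2 * a N))ᶜ, ∀ ζ : ℂ,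
        ((a N : ℂ) * ζ ^ 2 + (b N : ℂ) * ζ + (a N : ℂ) = l * ζ ∧ ‖ζ‖ < 1) ↔ ζ = z l) ∧
      ∀ x ∈ Set.Ioo (b N - 2 * a N) (b N + 2 * a N),
        Tendsto z (𝓝[{l : ℂ | 0 < l.im}] (x : ℂ)) (𝓝 (Jacobi.boundaryRoot (a N) (b N) x))) ∧
    -- the denominator of the density does not vanish
    (∀ x ∈ Set.Ioo (b N - 2 * a N) (b N + 2 * a N),
      (((Jacobi.poly a b (N + 1)).eval x : ℝ) : ℂ)
        - Jacobi.boundaryRoot (a N) (b N) x * (((Jacobi.poly a b N).eval x : ℝ) : ℂ) ≠ 0) ∧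
    -- the spectral measure has this density on the interval
    IsProbabilityMeasure (Jacobi.stabilizedMeasure a b N) ∧
    (Jacobi.stabilizedMeasure a b N).restrict (Set.Ioo (b N - 2 * a N) (b N + 2 * a N)) =
      (volume.restrict (Set.Ioo (b N - 2 * a N) (b N + 2 * a N))).withDensity
        (fun x => ENNReal.ofReal (Jacobi.density a b N x)) ∧
    -- and its distribution function has this derivative at every point of the interval
    ∀ x ∈ Set.Ioo (b N - 2 * a N) (b N + 2 * a N),
      HasDerivAt (fun t : ℝ => (Jacobi.stabilizedMeasure a b N).real (Set.Iic t))
        (Jacobi.density a b N x) x := by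
  have hN := ha N
  have hcont := Jacobi.continuousOn_im_weyl_stabilize ha b N
  have hpoisson := Jacobi.integral_poissonKernel_stabilizedMeasure ha b N
  have hprob := Jacobi.isProbabilityMeasure_stabilizedMeasure a b N
  refine ⟨⟨fun l => Jacobi.innerRoot ((l - b N) / (2 * a N)), ?_, ?_, ?_⟩, ?_, hprob, ?_, ?_⟩
  · intro l hl
    have h2 : (2 * (a N : ℂ)) ≠ 0 := by exact_mod_cast (by positivity : 2 * a N ≠ 0)
    exact AnalyticAt.comp (f := fun l : ℂ => (l - b N) / (2 * a N))
      (Jacobi.analyticAt_innerRoot (Jacobi.affine_notMem_segment hN (b N) hl))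
      ((analyticAt_id.sub analyticAt_const).div analyticAt_const h2)
  · intro l hl ζ
    have hw := Jacobi.affine_notMem_segment hN (b N) hl
    have hw0 : (l - b N) / (2 * a N) ≠ 0 := fun h => hw ⟨0, by norm_num, by simp [h]⟩
    rw [Jacobi.characteristic_iff hN]
    exact Jacobi.isRoot_and_norm_lt_one_iff (Jacobi.innerRoot_isRoot hw0)
      (Jacobi.norm_innerRoot_lt_one hw) ζ
  · exact fun x hx => Jacobi.tendsto_innerRoot_boundaryRoot hN (b N) hx
  · intro x hx
    have h := Jacobi.poly_succ_sub_mul_ne_zero_of_real (b := b) ha (N := N) (x := x)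
      (Jacobi.im_boundaryRoot_neg hN (b N) hx).ne
    rwa [← Complex.coe_algebraMap, aeval_algebraMap_apply_eq_algebraMap_eval,
      aeval_algebraMap_apply_eq_algebraMap_eval] at h
  · rw [Jacobi.restrict_eq_withDensity_of_poissonIntegral hcont hpoisson]
    · refine withDensity_congr_ae ?_
      filter_upwards [ae_restrict_mem measurableSet_Ioo] with x hx
      rw [Jacobi.im_weyl_stabilize ha b N hx]
    · intro x hx
      have h := Jacobi.density_nonneg ha b N x
      rw [← Jacobi.im_weyl_stabilize ha b N hx] at h
      simpa using (le_div_iff₀ Real.pi_pos).1 h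
  · intro x hx
    rw [← Jacobi.im_weyl_stabilize ha b N hx]
    exact Jacobi.hasDerivAt_measureReal_Iic_of_poissonIntegral hcont hpoisson hx
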